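/- Let $n \ge 2$. For a word $w = w(1)w(2)\cdots w(m)$ of positive integers, let $\operatorname{des}(w)$ be the number of descents of $w$, i.e. of indices $k$ with $1 \le k < m$ and $w(k) > w(k+1)$, and let $\operatorname{peaks}(w)$ be the number of peaks of $w$, i.e. of indices $i$ with $1 < i < m$ and $w(i-1) < w(i) > w(i+1)$. The runs of $w$ are its maximal weakly increasing blocks of consecutive letters, and $\operatorname{runsort}(w)$ is the word obtained by rearranging the runs of $w$ in lexicographic order and concatenating them. A permutation $\sigma \in S_n$ is identified with the word $\sigma(1)\sigma(2)\cdots\sigma(n)$. **Theorem.** If $\sigma \in S_n$ is chosen uniformly at random, then $$\mathbb{E}[\operatorname{des}(\operatorname{runsort}(\sigma))] = \mathbb{E}[\operatorname{peaks}(\operatorname{runsort}(\sigma))] = \mathbb{E}[\operatorname{peaks}(\sigma)] = \frac{n-2}{3}.$$ -/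

import Mathlib

open scoped BigOperators

namespace RunSort

/-- The one-line notation `σ(1) σ(2) ⋯ σ(n)` of a permutation of `{1, …, n}`, as a word. The
element `j : Fin n` stands for `j + 1`. -/
def oneLine {n : ℕ} (σ : Equiv.Perm (Fin n)) : List ℕ :=
  List.ofFn fun i => (σ i : ℕ) + 1

/-- The `k`-th letter `w(k)` of the word `w`, counted from `1`; it is only used at positions
`1 ≤ k ≤ w.length`. -/
def letter (w : List ℕ) (k : ℕ) : ℕ :=
  w.getD (k - 1) 0

/-- The descent set of a word of length `n`: those `k` with `1 ≤ k < n` and `w(k) > w(k+1)`. -/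
def descents (w : List ℕ) : Finset ℕ :=
  {k ∈ Finset.Ico 1 w.length | letter w (k + 1) < letter w k}

/-- The number of descents. -/
def des (w : List ℕ) : ℕ :=
  (descents w).card

/-- The set of peaks of a word of length `n`: those `i` with `1 < i < n` and
`w(i-1) < w(i) > w(i+1)`. -/
def peakSet (w : List ℕ) : Finset ℕ :=
  {i ∈ Finset.Ioo 1 w.length | letter w (i - 1) < letter w i ∧ letter w (i + 1) < letter w i}

/-- The number of peaks. -/
def peaks (w : List ℕ) : ℕ :=
  (peakSet w).card

/-- The runs of a word, from left to right: its maximal weakly increasing blocks of consecutive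
letters, obtained by cutting the word at each descent. -/
def runs (w : List ℕ) : List (List ℕ) :=
  w.splitBy fun a b => decide (a ≤ b)

/-- The word obtained by rearranging the runs in lexicographic order (the order `≤` on lists)
and concatenating them. -/
def runsort (w : List ℕ) : List ℕ :=
  ((runs w).mergeSort fun u v => decide (u ≤ v)).flatten

end RunSort

namespace RunSort

/-! The letters are distinct, so descents and peaks can be counted by the value `v` at their top,
and values, unlike positions, survive the rearrangement of runs.

In the sorted word the heads of the runs increase. A descent can only occur after the last letter
`v` of a run, and then the head `c` of the next run satisfies `a < c < v`, with `a` the head of the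
run of `v`. So that run has at least two letters, the descent is a peak, and the tops of both are
exactly the `v` that are crossed: some run starts strictly between `a` and `v` (`tops_runsort`).

Call `v` a long end of `w` if it ends a run whose head is smaller. Long ends are the disjoint union
of crossed and uncrossed ends, and also of peak tops and a final letter reached by an ascent. For
fixed `v` it therefore suffices that the words with `v` uncrossed are as many as those with a final
ascent into `v`, or, by reversal, those starting with a descent from `v`. The bijection is `B ++ Z
++ v :: Y ↔ v :: (Z ++ B ++ Y)`, where `B` is a block of letters above `v` and `Z` ends with the
part below `v` of the run with the largest head below `v` (`isSplit_unique`, `exists_isSplit`,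
`isUncrossedEnd_iff`). Summing over `v` gives the equality of expectations.

Finally each of the `n - 2` interior positions is a peak with probability `1/3`. -/

/-- `v` is the larger letter of a descent of `w`. -/
def IsDescTop (w : List ℕ) (v : ℕ) : Prop :=
  ∃ X q Y, w = X ++ v :: q :: Y ∧ q < v

/-- `v` is the value of `w` at a peak. -/
def IsPeakTop (w : List ℕ) (v : ℕ) : Prop :=
  ∃ X p q Y, w = X ++ p :: v :: q :: Y ∧ p < v ∧ q < v

/-- `b` is the first letter of a run of `w`. -/
def IsStart (w : List ℕ) (b : ℕ) : Prop :=
  ∃ X Y, w = X ++ b :: Y ∧ ∀ x ∈ X.getLast?, b < x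

/-! ### Descents and peaks identified by their values -/

theorem letter_injOn {w : List ℕ} (hw : w.Nodup) :
    Set.InjOn (letter w) (Set.Icc 1 w.length) := by
  intro i hi j hj h
  simp only [Set.mem_Icc] at hi hj
  unfold letter at h
  rw [List.getD_eq_getElem _ _ (by omega), List.getD_eq_getElem _ _ (by omega)] at h
  have := (hw.getElem_inj_iff).1 h
  omega

theorem letter_append_length_add (X Y : List ℕ) (k : ℕ) (hk : 1 ≤ k) :
    letter (X ++ Y) (X.length + k) = letter Y k := by
  unfold letter
  rw [List.getD_append_right _ _ _ _ (by omega)]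
  congr 1
  omega

theorem eq_take_append_letter_cons (w : List ℕ) {k : ℕ} (h1 : 1 ≤ k) (h2 : k ≤ w.length) :
    w.drop (k - 1) = letter w k :: w.drop k := by
  rw [List.drop_eq_getElem_cons (by omega)]
  unfold letter
  rw [List.getD_eq_getElem _ _ (by omega)]
  congr 2
  omega

theorem des_eq_ncard {w : List ℕ} (hw : w.Nodup) : des w = {v | IsDescTop w v}.ncard := by
  have h : {v | IsDescTop w v} = letter w '' (descents w : Set ℕ) := by
    ext v
    simp only [Set.mem_ofPred_eq, Set.mem_image, descents, Finset.coe_filter, Finset.mem_Ico]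
    constructor
    · rintro ⟨X, q, Y, rfl, hq⟩
      refine ⟨X.length + 1, ⟨⟨by omega, by simp⟩, ?_⟩, ?_⟩
      · rw [add_assoc, letter_append_length_add _ _ _ (by omega),
          letter_append_length_add _ _ _ (by omega)]
        simpa [letter] using hq
      · rw [letter_append_length_add _ _ _ (by omega)]
        simp [letter]
    · rintro ⟨k, ⟨⟨h1, h2⟩, h3⟩, rfl⟩
      refine ⟨w.take (k - 1), letter w (k + 1), w.drop (k + 1), ?_, h3⟩
      have e1 := eq_take_append_letter_cons w h1 h2.le
      have e2 := eq_take_append_letter_cons w (k := k + 1) (by omega) (by omega)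
      rw [Nat.add_sub_cancel] at e2
      rw [← e2, ← e1, List.take_append_drop]
  rw [h, Set.InjOn.ncard_image, Set.ncard_coe_finset, des]
  refine (letter_injOn hw).mono fun k hk => ?_
  simp only [descents, Finset.coe_filter, Finset.mem_Ico, Set.mem_ofPred_eq] at hk
  exact ⟨hk.1.1, hk.1.2.le⟩

theorem peaks_eq_ncard {w : List ℕ} (hw : w.Nodup) : peaks w = {v | IsPeakTop w v}.ncard := by
  have h : {v | IsPeakTop w v} = letter w '' (peakSet w : Set ℕ) := by
    ext v
    simp only [Set.mem_ofPred_eq, Set.mem_image, peakSet, Finset.coe_filter, Finset.mem_Ioo]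
    constructor
    · rintro ⟨X, p, q, Y, rfl, hp, hq⟩
      refine ⟨X.length + 2, ⟨⟨by omega, by simp⟩, ?_, ?_⟩, ?_⟩
      · rw [Nat.add_sub_assoc (by omega), letter_append_length_add _ _ _ (by omega),
          letter_append_length_add _ _ _ (by omega)]
        simpa [letter] using hp
      · rw [add_assoc, letter_append_length_add _ _ _ (by omega),
          letter_append_length_add _ _ _ (by omega)]
        simpa [letter] using hq
      · rw [letter_append_length_add _ _ _ (by omega)]
        simp [letter]
    · rintro ⟨k, ⟨⟨h1, h2⟩, h3, h4⟩, rfl⟩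
      refine ⟨w.take (k - 2), letter w (k - 1), letter w (k + 1), w.drop (k + 1), ?_, h3, h4⟩
      have e0 := eq_take_append_letter_cons w (k := k - 1) (by omega) (by omega)
      have e1 := eq_take_append_letter_cons w (k := k) (by omega) h2.le
      have e2 := eq_take_append_letter_cons w (k := k + 1) (by omega) (by omega)
      rw [Nat.add_sub_cancel] at e2
      rw [← e2, ← e1, ← e0, Nat.sub_sub, List.take_append_drop]
  rw [h, Set.InjOn.ncard_image, Set.ncard_coe_finset, peaks]
  refine (letter_injOn hw).mono fun k hk => ?_
  simp only [peakSet, Finset.coe_filter, Finset.mem_Ioo, Set.mem_ofPred_eq] at hk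
  exact ⟨hk.1.1.le, hk.1.2.le⟩

/-! ### Runs and their heads -/

theorem runs_append {X Y : List ℕ} (h : ∀ x ∈ X.getLast?, ∀ y ∈ Y.head?, y < x) :
    runs (X ++ Y) = runs X ++ runs Y :=
  List.splitBy_append fun x hx y hy => by simpa using h x hx y hy

theorem mem_runs_iff {w A : List ℕ} :
    A ∈ runs w ↔ A ≠ [] ∧ A.IsChain (· ≤ ·) ∧ ∃ X Y, w = X ++ A ++ Y ∧
      (∀ x ∈ X.getLast?, ∀ a ∈ A.head?, a < x) ∧ (∀ a ∈ A.getLast?, ∀ y ∈ Y.head?, y < a) := by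
  constructor
  · intro hA
    have h1 : A ≠ [] := List.ne_nil_of_mem_splitBy hA
    have h2 := List.isChain_of_mem_splitBy hA
    refine ⟨h1, by simpa using h2, ?_⟩
    have hc := List.isChain_getLast_head_splitBy (fun a b : ℕ => decide (a ≤ b)) w
    have hf := List.flatten_splitBy (fun a b : ℕ => decide (a ≤ b)) w
    obtain ⟨L1, L2, hL⟩ := List.append_of_mem hA
    rw [runs] at hL
    rw [hL] at hc hf
    refine ⟨L1.flatten, L2.flatten, by simp [← hf], ?_, ?_⟩
    · intro x hx a ha
      rcases List.eq_nil_or_concat' L1 with rfl | ⟨M, C, rfl⟩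
      · simp at hx
      · rw [List.append_assoc, List.singleton_append, List.isChain_append_cons_cons] at hc
        obtain ⟨hC, hA', h⟩ := hc.2.1
        rw [List.flatten_append, List.flatten_singleton, List.getLast?_append_of_ne_nil _ hC,
          List.getLast?_eq_some_getLast hC] at hx
        rw [List.head?_eq_some_head h1] at ha
        simp only [Option.mem_def, Option.some.injEq] at hx ha
        subst hx ha
        simpa using h
    · intro a ha y hy
      rcases L2 with _ | ⟨C, M⟩
      · simp at hy
      · rw [List.isChain_append_cons_cons] at hc
        obtain ⟨hA', hC, h⟩ := hc.2.1
        rw [List.flatten_cons, List.head?_append_of_ne_nil _ hC, List.head?_eq_some_head hC] at hy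
        rw [List.getLast?_eq_some_getLast h1] at ha
        simp only [Option.mem_def, Option.some.injEq] at hy ha
        subst hy ha
        simpa using h
  · rintro ⟨h1, h2, X, Y, rfl, h3, h4⟩
    rw [List.append_assoc, runs_append, runs_append h4]
    · simp only [List.mem_append]
      right; left
      rw [runs, List.splitBy_of_isChain h1 (by simpa using h2)]
      simp
    · intro x hx y hy
      rw [List.head?_append_of_ne_nil _ h1] at hy
      exact h3 x hx y hy

theorem isStart_iff_mem_runs {w : List ℕ} {b : ℕ} :
    IsStart w b ↔ ∃ A ∈ runs w, A.head? = some b := by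
  constructor
  · rintro ⟨X, Y, rfl, h⟩
    rw [runs_append (by simpa using h)]
    have hne : runs (b :: Y) ≠ [] := List.splitBy_ne_nil.2 (by simp)
    refine ⟨(runs (b :: Y)).head hne, ?_, ?_⟩
    · simp
    · have := List.head_head_splitBy (fun a b : ℕ => decide (a ≤ b)) (l := b :: Y) (by simp)
      rw [List.head?_eq_some_head (List.ne_nil_of_mem_splitBy (List.head_mem hne))]
      simpa [runs] using this
  · rintro ⟨A, hA, hb⟩
    obtain ⟨h1, h2, X, Y, rfl, h3, h4⟩ := mem_runs_iff.1 hA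
    rcases A with _ | ⟨a, A⟩
    · simp at hb
    · obtain rfl : a = b := by simpa using hb
      exact ⟨X, A ++ Y, by simp, fun x hx => h3 x hx a (by simp)⟩

theorem eq_of_append_cons_eq {X Y X' Y' : List ℕ} {v : ℕ} (h : (X ++ v :: Y).Nodup)
    (e : X ++ v :: Y = X' ++ v :: Y') : X = X' ∧ Y = Y' := by
  have h1 : v ∉ X := by
    intro hx
    exact (List.nodup_append.1 h).2.2 v hx v (by simp) rfl
  have h2 : v ∉ X' := by
    rw [e] at h
    intro hx
    exact (List.nodup_append.1 h).2.2 v hx v (by simp) rfl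
  have h3 : X = X' := by
    have := congrArg (List.takeWhile fun x => decide (x ≠ v)) e
    rwa [List.takeWhile_append_of_pos, List.takeWhile_append_of_pos, List.takeWhile_cons,
      List.takeWhile_cons, if_neg (by simp), if_neg (by simp), List.append_nil,
      List.append_nil] at this
    · intro x hx
      simp only [decide_eq_true_eq]
      rintro rfl
      exact h2 hx
    · intro x hx
      simp only [decide_eq_true_eq]
      rintro rfl
      exact h1 hx
  subst h3
  simpa using e

theorem getLast?_cons_concat (a v : ℕ) (R : List ℕ) : (a :: (R ++ [v])).getLast? = some v := by
  rw [← List.cons_append, List.getLast?_concat]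

/-! ### Ends of runs: long, crossed, uncrossed -/

/-- `v` ends a run of `w` with at least two letters, in the sense that its first letter is smaller
than `v`. -/
def IsLongEnd (w : List ℕ) (v : ℕ) : Prop :=
  ∃ A ∈ runs w, v ∈ A.getLast? ∧ ∃ a ∈ A.head?, a < v

/-- `v` ends a run of `w` and some run starts strictly between the first letter of that run
and `v`. -/
def IsCrossedEnd (w : List ℕ) (v : ℕ) : Prop :=
  ∃ A ∈ runs w, v ∈ A.getLast? ∧ ∃ a ∈ A.head?, ∃ b, IsStart w b ∧ a < b ∧ b < v

/-- `v` ends a run of `w` with at least two letters and no run starts strictly between the first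
letter of that run and `v`. -/
def IsUncrossedEnd (w : List ℕ) (v : ℕ) : Prop :=
  ∃ A ∈ runs w, v ∈ A.getLast? ∧ ∃ a ∈ A.head?, a < v ∧ ∀ b, IsStart w b → b < v → b ≤ a

theorem eq_of_mem_runs_of_mem {w A B : List ℕ} {v : ℕ} (hw : w.Nodup) (hA : A ∈ runs w)
    (hB : B ∈ runs w) (h1 : v ∈ A) (h2 : v ∈ B) : A = B := by
  have h : (runs w).flatten.Nodup := by
    rw [runs, List.flatten_splitBy]; exact hw
  rw [List.nodup_flatten] at h
  by_contra hne
  have : Std.Symm (List.Disjoint (α := ℕ)) := ⟨fun _ _ h => h.symm⟩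
  exact h.2.forall hA hB hne h1 h2

theorem runsort_perm (w : List ℕ) : (runsort w).Perm w := by
  have := (List.mergeSort_perm (runs w) fun u v => decide (u ≤ v)).flatten
  rwa [runs, List.flatten_splitBy] at this

theorem isLongEnd_iff_crossed_or_uncrossed {w : List ℕ} {v : ℕ} :
    IsLongEnd w v ↔ IsCrossedEnd w v ∨ IsUncrossedEnd w v := by
  constructor
  · rintro ⟨A, hA, hv, a, ha, hav⟩
    by_cases h : ∃ b, IsStart w b ∧ a < b ∧ b < v
    · exact Or.inl ⟨A, hA, hv, a, ha, h⟩
    · push Not at h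
      refine Or.inr ⟨A, hA, hv, a, ha, hav, fun b hb hbv => ?_⟩
      by_contra hab
      exact absurd (h b hb (by omega)) (by omega)
  · rintro (⟨A, hA, hv, a, ha, b, hb, h1, h2⟩ | ⟨A, hA, hv, a, ha, h, -⟩)
    · exact ⟨A, hA, hv, a, ha, h1.trans h2⟩
    · exact ⟨A, hA, hv, a, ha, h⟩

theorem not_uncrossed_of_crossed {w : List ℕ} {v : ℕ} (hw : w.Nodup) (h : IsCrossedEnd w v) :
    ¬ IsUncrossedEnd w v := by
  obtain ⟨A, hA, hv, a, ha, b, hb, h1, h2⟩ := h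
  rintro ⟨B, hB, hv', a', ha', -, h⟩
  obtain rfl := eq_of_mem_runs_of_mem hw hA hB (List.mem_of_getLast? hv)
    (List.mem_of_getLast? hv')
  obtain rfl : a = a' := by rw [Option.mem_def] at ha ha'; simpa [ha] using ha'
  exact absurd (h b hb h2) (by omega)

theorem exists_concat_of_getLast? {A : List ℕ} {v : ℕ} (h : v ∈ A.getLast?) :
    ∃ B, A = B ++ [v] := by
  rcases List.eq_nil_or_concat' A with rfl | ⟨B, x, rfl⟩
  · simp at h
  · obtain rfl : x = v := by simpa using h
    exact ⟨B, rfl⟩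

theorem exists_append_pair {A : List ℕ} {a v : ℕ} (hA : A.Nodup) (hc : A.IsChain (· ≤ ·))
    (hv : v ∈ A.getLast?) (ha : a ∈ A.head?) (hav : a < v) :
    ∃ B p, A = B ++ [p, v] ∧ p < v := by
  obtain ⟨B, rfl⟩ := exists_concat_of_getLast? hv
  rcases List.eq_nil_or_concat' B with rfl | ⟨C, p, rfl⟩
  · simp at ha; omega
  · refine ⟨C, p, by simp, ?_⟩
    have h1 : p ≤ v := by
      rw [List.append_assoc, List.singleton_append, List.isChain_append_cons_cons] at hc
      exact hc.2.1
    have h2 : p ≠ v := by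
      rintro rfl
      simp [List.nodup_append] at hA
    omega

/-- Both sides say that `v` is preceded by a smaller letter and not followed by a larger one; the
two alternatives are whether a next letter exists. -/
theorem isLongEnd_iff {w : List ℕ} {v : ℕ} (hw : w.Nodup) :
    IsLongEnd w v ↔ IsPeakTop w v ∨ ∃ X p, w = X ++ [p, v] ∧ p < v := by
  have key : IsLongEnd w v ↔
      ∃ X p Y, w = X ++ p :: v :: Y ∧ p < v ∧ ∀ y ∈ Y.head?, y < v := by
    constructor
    · rintro ⟨A, hA, hv, a, ha, hav⟩
      obtain ⟨h1, h2, X, Y, rfl, h3, h4⟩ := mem_runs_iff.1 hA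
      have hAn : A.Nodup := by
        rw [List.append_assoc] at hw
        exact (List.nodup_append.1 (List.nodup_append.1 hw).2.1).1
      obtain ⟨B, p, rfl, hp⟩ := exists_append_pair hAn h2 hv ha hav
      exact ⟨X ++ B, p, Y, by simp, hp, h4 v hv⟩
    · rintro ⟨X, p, Y, rfl, hp, hY⟩
      obtain ⟨A, hA, hvA⟩ : ∃ A ∈ runs (X ++ p :: v :: Y), v ∈ A := by
        rw [← List.mem_flatten, runs, List.flatten_splitBy]
        simp
      refine ⟨A, hA, ?_⟩
      obtain ⟨h1, h2, X', Y', e, h3, h4⟩ := mem_runs_iff.1 hA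
      obtain ⟨A1, A2, rfl⟩ := List.append_of_mem hvA
      rw [List.append_cons, List.append_assoc X', List.append_assoc A1, List.cons_append,
        ← List.append_assoc] at e
      obtain ⟨e1, e2⟩ := eq_of_append_cons_eq (by simpa using hw) e
      have h5 : A2 = [] := by
        rcases A2 with _ | ⟨y, A2⟩
        · rfl
        · have : y < v := hY y (by simp [e2])
          rw [List.isChain_append_cons_cons] at h2
          omega
      subst h5
      refine ⟨by simp, ?_⟩
      rcases A1 with _ | ⟨a, A1⟩
      -- A run consisting of `v` alone would need the preceding letter `p` to exceed `v`.
      · have := h3 p (by rw [List.append_nil] at e1; simp [← e1]) v (by simp)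
        omega
      · refine ⟨a, by simp, ?_⟩
        have h6 : a ≤ v := by
          have := h2.pairwise
          simp at this
          exact this.1 v (Or.inr rfl)
        have h7 : a ≠ v := by
          rintro rfl
          have : a ∈ X ++ [p] := by rw [e1]; simp
          rw [List.append_cons] at hw
          exact (List.nodup_append.1 hw).2.2 a this a (by simp) rfl
        omega
  rw [key]
  constructor
  · rintro ⟨X, p, Y, rfl, hp, hY⟩
    rcases Y with _ | ⟨q, Y⟩
    · exact Or.inr ⟨X, p, rfl, hp⟩
    · exact Or.inl ⟨X, p, q, Y, rfl, hp, hY q (by simp)⟩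
  · rintro (⟨X, p, q, Y, rfl, hp, hq⟩ | ⟨X, p, rfl, hp⟩)
    · exact ⟨X, p, q :: Y, rfl, hp, by simpa using hq⟩
    · exact ⟨X, p, [], rfl, hp, by simp⟩

/-! ### Descents and peaks after sorting the runs -/

theorem head_le_head_of_le {A B : List ℕ} {a b : ℕ} (h : A ≤ B) (ha : a ∈ A.head?)
    (hb : b ∈ B.head?) : a ≤ b := by
  rcases A with _ | ⟨a', A⟩
  · simp at ha
  rcases B with _ | ⟨b', B⟩
  · simp at hb
  obtain rfl : a' = a := by simpa using ha
  obtain rfl : b' = b := by simpa using hb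
  by_contra hlt
  exact absurd (List.lt_iff_lex_lt _ _ |>.2 (List.Lex.rel (not_le.1 hlt))) (not_lt.2 h)

theorem tops_runsort {w : List ℕ} {v : ℕ} (hw : w.Nodup) :
    (IsDescTop (runsort w) v ↔ IsCrossedEnd w v) ∧
      (IsPeakTop (runsort w) v ↔ IsCrossedEnd w v) := by
  set L := (runs w).mergeSort fun u v => decide (u ≤ v) with hL
  have hmem : ∀ {A}, A ∈ L ↔ A ∈ runs w := fun {A} => List.mem_mergeSort
  have hLw : L.flatten.Nodup := (runsort_perm w).nodup_iff.2 hw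
  have hsort : L.Pairwise (· ≤ ·) := by
    have := List.pairwise_mergeSort (le := fun u v : List ℕ => decide (u ≤ v))
      (by simpa using fun a b c => le_trans) (by simpa using le_total) (runs w)
    simpa [hL] using this
  have hnd : ∀ A ∈ L, A.Nodup := (List.nodup_flatten.1 hLw).1
  have hchain : ∀ A ∈ L, A ≠ [] ∧ A.IsChain (· ≤ ·) := fun A hA =>
    ⟨(mem_runs_iff.1 (hmem.1 hA)).1, (mem_runs_iff.1 (hmem.1 hA)).2.1⟩
  have h1 : IsDescTop (runsort w) v → IsCrossedEnd w v := by
    rintro ⟨X, q, Y, e, hq⟩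
    change L.flatten = _ at e
    obtain ⟨A, hA, hvA⟩ : ∃ A ∈ L, v ∈ A := by
      rw [← List.mem_flatten, e]; simp
    obtain ⟨L1, L2, hL12⟩ := List.append_of_mem hA
    obtain ⟨A1, A2, rfl⟩ := List.append_of_mem hvA
    have hc := (hchain _ hA).2
    rw [hL12] at e hLw hsort
    have e' : (L1.flatten ++ A1) ++ v :: (A2 ++ L2.flatten) = X ++ v :: (q :: Y) := by
      rw [← e]; simp
    obtain ⟨e1, e2⟩ := eq_of_append_cons_eq (by simpa using hLw) e'
    -- Runs increase, so the descent at `v` forces `v` to be the last letter of its run, and `q` is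
    -- the head of the next one.
    have h5 : A2 = [] := by
      rcases A2 with _ | ⟨y, A2⟩
      · rfl
      · obtain rfl : y = q := by simp at e2; exact e2.1
        rw [List.isChain_append_cons_cons] at hc
        omega
    subst h5
    rcases L2 with _ | ⟨B, L2⟩
    · simp at e2
    have hB : B ∈ L := by rw [hL12]; simp
    rcases B with _ | ⟨q', B⟩
    · exact absurd rfl (hchain _ hB).1
    obtain rfl : q' = q := by simp at e2; exact e2.1
    obtain ⟨a, ha⟩ : ∃ a, a ∈ (A1 ++ [v]).head? := by cases A1 <;> simp
    refine ⟨A1 ++ [v], hmem.1 hA, by simp, a, ha, q', ?_, ?_, hq⟩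
    · exact isStart_iff_mem_runs.2 ⟨_, hmem.1 hB, by simp⟩
    · have hle : a ≤ q' := by
        refine head_le_head_of_le (B := q' :: B) ?_ ha (by simp)
        have := (List.pairwise_append.1 hsort).2.1
        rw [List.pairwise_cons] at this
        exact this.1 _ (by simp)
      have hne : a ≠ q' := by
        rintro rfl
        have := (List.nodup_flatten.1 hLw).2
        have := (List.pairwise_append.1 this).2.1
        rw [List.pairwise_cons] at this
        exact this.1 (a :: B) (by simp) (List.mem_of_mem_head? ha) (by simp)
      omega
  have h2 : IsCrossedEnd w v → IsPeakTop (runsort w) v := by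
    rintro ⟨A, hA, hv, a, ha, b, hb, hab, hbv⟩
    obtain ⟨B, hB, hbB⟩ := isStart_iff_mem_runs.1 hb
    rw [← hmem] at hA hB
    obtain ⟨L1, L2, hL12⟩ := List.append_of_mem hA
    -- The run with head `b > a` is sorted after `A`, so the run `C` right after `A` has head `c ≤ b
    -- < v`.
    have hB2 : B ∈ L2 := by
      rw [hL12] at hB hsort
      simp only [List.mem_append, List.mem_cons] at hB
      rcases hB with hB | rfl | hB
      · have := head_le_head_of_le ((List.pairwise_append.1 hsort).2.2 B hB A (by simp)) hbB ha
        omega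
      · simp only [Option.mem_def] at ha
        rw [hbB] at ha
        simp at ha
        omega
      · exact hB
    rcases L2 with _ | ⟨C, L2⟩
    · simp at hB2
    have hC : C ∈ L := by rw [hL12]; simp
    rcases C with _ | ⟨c, C⟩
    · exact absurd rfl (hchain _ hC).1
    have hcb : c ≤ b := by
      rw [hL12] at hsort
      have := (List.pairwise_append.1 hsort).2.1
      rw [List.pairwise_cons, List.pairwise_cons] at this
      rw [List.mem_cons] at hB2
      rcases hB2 with rfl | hB2
      · simp at hbB; omega
      · exact head_le_head_of_le (this.2.1 B hB2) (by simp) hbB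
    obtain ⟨A', p, rfl, hp⟩ := exists_append_pair (hnd A hA) (hchain A hA).2 hv ha (hab.trans hbv)
    refine ⟨L1.flatten ++ A', p, c, C ++ L2.flatten, ?_, hp, by omega⟩
    change L.flatten = _
    rw [hL12]
    simp
  have h3 : IsPeakTop (runsort w) v → IsDescTop (runsort w) v := by
    rintro ⟨X, p, q, Y, e, -, hq⟩
    exact ⟨X ++ [p], q, Y, by simp [e], hq⟩
  exact ⟨⟨h1, fun h => h3 (h2 h)⟩, ⟨fun h => h1 (h3 h), h2⟩⟩

/-! ### The rearrangement `B ++ Z ++ v :: Y ↔ v :: (Z ++ B ++ Y)` -/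

theorem mem_of_isStart {w : List ℕ} {b : ℕ} (h : IsStart w b) : b ∈ w := by
  obtain ⟨X, Y, rfl, -⟩ := h
  simp

theorem IsStart.append_right {P : List ℕ} {b : ℕ} (h : IsStart P b) (Q : List ℕ) :
    IsStart (P ++ Q) b := by
  obtain ⟨X, Y, rfl, h⟩ := h
  exact ⟨X, Y ++ Q, by simp, h⟩

theorem IsStart.append_left {P Q : List ℕ} {b : ℕ} (h : IsStart Q b)
    (hP : ∀ x ∈ P.getLast?, b < x) : IsStart (P ++ Q) b := by
  obtain ⟨X, Y, rfl, h⟩ := h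
  refine ⟨P ++ X, Y, by simp, ?_⟩
  rcases List.eq_nil_or_concat' X with rfl | ⟨X, x, rfl⟩
  · simpa using hP
  · simpa using h

theorem isStart_append {P Q : List ℕ} {b : ℕ} (h : IsStart (P ++ Q) b) :
    IsStart P b ∨ IsStart Q b := by
  obtain ⟨X, Y, e, h⟩ := h
  rcases List.append_eq_append_iff.1 e with ⟨Z, rfl, rfl⟩ | ⟨Z, rfl, e2⟩
  · right
    refine ⟨Z, Y, rfl, ?_⟩
    rcases List.eq_nil_or_concat' Z with rfl | ⟨X, x, rfl⟩
    · simp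
    · simpa using h
  · rcases Z with _ | ⟨z, Z⟩
    · right
      exact ⟨[], Y, by simpa using e2.symm, by simp⟩
    · left
      obtain rfl : b = z := by simp at e2; exact e2.1
      exact ⟨X, Z, rfl, h⟩

theorem eq_of_isStart_of_isChain {R : List ℕ} {a b : ℕ} (hc : (a :: R).IsChain (· < ·))
    (h : IsStart (a :: R) b) : b = a := by
  obtain ⟨X, Y, e, h⟩ := h
  rcases List.eq_nil_or_concat' X with rfl | ⟨X, x, rfl⟩
  · simp at e; exact e.1.symm
  · rw [e, List.append_assoc, List.singleton_append, List.isChain_append_cons_cons] at hc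
    have := h x (by simp)
    omega

/-- `Z` ends with letters below `v` of the run whose first letter is the largest one below `v`
among the first letters of runs of `Z` and of `Y`. -/
def Cut (v : ℕ) (Z Y : List ℕ) : Prop :=
  ∃ Z0 a R, Z = Z0 ++ a :: R ∧ (a :: R).IsChain (· < ·) ∧ (∀ x ∈ a :: R, x < v) ∧
    (∀ x ∈ Z0.getLast?, a < x) ∧ (∀ b, IsStart Z0 b → b < v → b < a) ∧
    (∀ b, IsStart Y b → b < v → b < a)

/-- The data that describe both a word `B ++ Z ++ v :: Y` in which `v` is an uncrossed end of a
run, and a word `v :: (Z ++ B ++ Y)` which starts with a descent. -/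
structure IsSplit (v : ℕ) (B Z Y : List ℕ) : Prop where
  lt_of_mem : ∀ x ∈ B, v < x
  head_left : ∀ x ∈ Z.head?, x < v
  cut : Cut v Z Y
  head_right : ∀ y ∈ Y.head?, y < v

theorem takeWhile_append_eq {p : ℕ → Bool} {X Y : List ℕ} (hX : ∀ x ∈ X, p x)
    (hY : ∀ y ∈ Y.head?, p y = false) : (X ++ Y).takeWhile p = X := by
  rw [List.takeWhile_append_of_pos hX]
  rcases Y with _ | ⟨y, Y⟩
  · simp
  · simp [hY y (by simp)]

theorem eq_and_eq_of_append_eq {p : ℕ → Bool} {X Y X' Y' : List ℕ} (e : X ++ Y = X' ++ Y')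
    (hX : ∀ x ∈ X, p x) (hX' : ∀ x ∈ X', p x)
    (hY : ∀ y ∈ Y.head?, p y = false) (hY' : ∀ y ∈ Y'.head?, p y = false) :
    X = X' ∧ Y = Y' := by
  have h : X = X' := by rw [← takeWhile_append_eq hX hY, e, takeWhile_append_eq hX' hY']
  subst h
  exact ⟨rfl, List.append_cancel_left e⟩

theorem exists_append_takeWhile (p : ℕ → Bool) (w : List ℕ) :
    ∃ X Y, w = X ++ Y ∧ (∀ x ∈ X, p x) ∧ ∀ y ∈ Y.head?, p y = false := by
  refine ⟨w.takeWhile p, w.dropWhile p, by simp, fun x hx => List.mem_takeWhile_imp hx, ?_⟩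
  intro y hy
  have := List.head?_dropWhile_not p w
  rw [Option.mem_def.1 hy] at this
  simpa using this

/-- The pieces can be read off `Z ++ B ++ Y`: `a` is its largest run head below `v`, `R` is the
maximal block after `a` of letters strictly between `a` and `v`, and `B` is the maximal block after
that of letters above `v`. -/
theorem isSplit_unique {v : ℕ} {B Z Y B' Z' Y' : List ℕ} (h : IsSplit v B Z Y)
    (h' : IsSplit v B' Z' Y') (hn : (Z ++ B ++ Y).Nodup) (e : Z ++ B ++ Y = Z' ++ B' ++ Y') :
    B = B' ∧ Z = Z' ∧ Y = Y' := by
  obtain ⟨hB, hZ, ⟨Z0, a, R, rfl, hc, hlt, hl, h1, h2⟩, hY⟩ := h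
  obtain ⟨hB', hZ', ⟨Z0', a', R', rfl, hc', hlt', hl', h1', h2'⟩, hY'⟩ := h'
  have bound : ∀ {B Z0 Y R : List ℕ} {a b : ℕ}, (∀ x ∈ B, v < x) → (a :: R).IsChain (· < ·) →
      (∀ b, IsStart Z0 b → b < v → b < a) → (∀ b, IsStart Y b → b < v → b < a) → b < v →
      IsStart (Z0 ++ a :: R ++ B ++ Y) b → b ≤ a := by
    intro B Z0 Y R a b hB hc h1 h2 hb hs
    rcases isStart_append hs with hs | hs
    · rcases isStart_append hs with hs | hs
      · rcases isStart_append hs with hs | hs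
        · exact (h1 b hs hb).le
        · exact (eq_of_isStart_of_isChain hc hs).le
      · have := hB b (mem_of_isStart hs)
        omega
    · exact (h2 b hs hb).le
  obtain rfl : a = a' := by
    apply le_antisymm
    · refine bound hB' hc' h1' h2' (hlt a (by simp)) ?_
      rw [← e]
      exact ⟨Z0, R ++ B ++ Y, by simp, hl⟩
    · refine bound hB hc h1 h2 (hlt' a' (by simp)) ?_
      rw [e]
      exact ⟨Z0', R' ++ B' ++ Y', by simp, hl'⟩
  simp only [List.append_assoc, List.cons_append] at e hn
  obtain ⟨rfl, eR⟩ := eq_of_append_cons_eq hn e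
  have range : ∀ {R : List ℕ}, (a :: R).IsChain (· < ·) → (∀ x ∈ a :: R, x < v) →
      ∀ x ∈ R, decide (a < x ∧ x < v) = true := by
    intro R hc hlt x hx
    have := (List.pairwise_cons.1 hc.pairwise).1 x hx
    simp [this, hlt x (by simp [hx])]
  have headFails : ∀ {B Y : List ℕ}, (∀ x ∈ B, v < x) → (∀ b, IsStart Y b → b < v → b < a) →
      (∀ y ∈ Y.head?, y < v) → ∀ y ∈ (B ++ Y).head?, decide (a < y ∧ y < v) = false := by
    intro B Y hB h2 hY y hy
    rcases B with _ | ⟨x, B⟩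
    · rcases Y with _ | ⟨z, Y⟩
      · simp at hy
      · obtain rfl : z = y := by simpa using hy
        have := h2 z ⟨[], Y, rfl, by simp⟩ (hY z (by simp))
        simp; omega
    · obtain rfl : x = y := by simpa using hy
      have := hB x (by simp)
      simp; omega
  obtain ⟨rfl, eB⟩ := eq_and_eq_of_append_eq (p := fun x => decide (a < x ∧ x < v)) eR
    (range hc hlt) (range hc' hlt') (headFails hB h2 hY) (headFails hB' h2' hY')
  obtain ⟨rfl, rfl⟩ := eq_and_eq_of_append_eq (p := fun x => decide (v < x)) eB
    (by simpa using hB) (by simpa using hB')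
    (fun y hy => by simpa using (hY y hy).le) (fun y hy => by simpa using (hY' y hy).le)
  simp

/-- The same recipe as for uniqueness produces a split. What needs proof is that the block after `a`
is increasing and that the heads in the remainder `Y` stay below `a`. -/
theorem exists_isSplit {v p : ℕ} {τ : List ℕ} (hn : (p :: τ).Nodup) (hv : v ∉ p :: τ)
    (hp : p < v) : ∃ B Z Y, IsSplit v B Z Y ∧ p :: τ = Z ++ B ++ Y := by
  classical
  -- The first letter `p` is itself a run head below `v`, so a largest one exists.
  obtain ⟨a, ha, hmax⟩ : ∃ a, (IsStart (p :: τ) a ∧ a < v) ∧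
      ∀ b, IsStart (p :: τ) b ∧ b < v → b ≤ a := by
    have hne : ((Finset.range v).filter (IsStart (p :: τ))).Nonempty :=
      ⟨p, by simp [hp]; exact ⟨[], τ, rfl, by simp⟩⟩
    refine ⟨Finset.max' _ hne, ?_, ?_⟩
    · have := Finset.max'_mem _ hne
      simp only [Finset.mem_filter, Finset.mem_range] at this
      exact ⟨this.2, this.1⟩
    · intro b hb
      exact Finset.le_max' _ _ (by simp [hb.1, hb.2])
  obtain ⟨⟨Z0, T, e, hl⟩, hav⟩ := ha
  obtain ⟨R, T', rfl, hR, hT'⟩ := exists_append_takeWhile (fun x => decide (a < x ∧ x < v)) T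
  obtain ⟨B, Y, rfl, hB, hY⟩ := exists_append_takeWhile (fun x => decide (v < x)) T'
  simp only [decide_eq_true_eq] at hR hB
  rw [e] at hn hv hmax
  have hvY : v ∉ Y := fun h => hv (by simp [h])
  have hYv : ∀ y ∈ Y.head?, y < v := by
    intro y hy
    have h1 := hY y hy
    have h2 : y ≠ v := by
      rintro rfl
      exact hvY (List.mem_of_mem_head? hy)
    simp at h1
    omega
  have hne : ∀ b ∈ Z0 ++ Y, b ≠ a := by
    rintro b hb rfl
    simp [List.nodup_append] at hn hb
    grind
  refine ⟨B, Z0 ++ a :: R, Y, ⟨hB, ?_, ⟨Z0, a, R, rfl, ?_, ?_, hl, ?_, ?_⟩, hYv⟩, by simp [e]⟩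
  · intro x hx
    have : x ∈ (p :: τ).head? := by
      rw [e]
      cases Z0 <;> simpa using hx
    simp at this
    omega
  -- A descent inside `a :: R` would start a run at a letter strictly between `a` and `v`, against
  -- the maximality of `a`.
  · rw [List.isChain_iff_forall_rel_of_append_cons_cons]
    intro x y l1 l2 hl
    by_contra hxy
    have hxyR : y ∈ R := by
      rcases l1 with _ | ⟨z, l1⟩ <;> simp at hl <;> simp [hl]
    have hne' : x ≠ y := by
      rintro rfl
      have : (l1 ++ x :: x :: l2).Nodup := by
        rw [← hl]
        exact hn.sublist (List.Sublist.trans (by simp) (List.sublist_append_right _ _))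
      simp [List.nodup_append] at this
    have := hmax y ⟨⟨Z0 ++ l1 ++ [x], l2 ++ (B ++ Y), ?_, ?_⟩, (hR y hxyR).2⟩
    · have := (hR y hxyR).1
      omega
    · have : a :: (R ++ (B ++ Y)) = (a :: R) ++ (B ++ Y) := rfl
      rw [this, hl]
      simp
    · simp; omega
  · intro x hx
    rw [List.mem_cons] at hx
    rcases hx with rfl | hx
    · exact hav
    · exact (hR x hx).2
  · intro b hb hbv
    have := hmax b ⟨hb.append_right _, hbv⟩
    have := hne b (by simp [mem_of_isStart hb])
    omega
  · intro b hb hbv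
    have hba := hne b (by simp [mem_of_isStart hb])
    -- A run head of `Y` might fail to be one in the whole word only if it is the first letter of
    -- `Y`. There it follows a letter of `B` above `v`, or, if `B` is empty, the maximality of `R`
    -- keeps it out of the interval between `a` and `v`.
    by_cases hstart : IsStart (Z0 ++ a :: (R ++ (B ++ Y))) b
    · have := hmax b ⟨hstart, hbv⟩
      omega
    by_contra hab
    apply hstart
    have : Z0 ++ a :: (R ++ (B ++ Y)) = (Z0 ++ a :: R ++ B) ++ Y := by simp
    rw [this]
    obtain ⟨X, Y', rfl, hX⟩ := hb
    rcases X with _ | ⟨z, X⟩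
    · refine IsStart.append_left ⟨[], Y', rfl, by simp⟩ ?_
      rcases List.eq_nil_or_concat' B with rfl | ⟨B, x, rfl⟩
      · have := hT' b (by simp)
        simp at this
        omega
      · have := hB x (by simp)
        intro y hy
        rw [← List.append_assoc, List.getLast?_concat] at hy
        obtain rfl : x = y := by simpa using hy
        omega
    · refine ⟨Z0 ++ a :: R ++ B ++ z :: X, Y', by simp, ?_⟩
      intro x hx
      apply hX
      rwa [List.getLast?_append_of_ne_nil _ (by simp)] at hx

/-- Here `B` is the longest prefix, before the run of `v`, of letters above `v`. Heads in `B` exceed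
`v` and so never cross; being uncrossed only constrains the heads in `Z` and `Y`. -/
theorem isUncrossedEnd_iff {w : List ℕ} {v : ℕ} (hw : w.Nodup) :
    IsUncrossedEnd w v ↔ ∃ B Z Y, IsSplit v B Z Y ∧ w = B ++ Z ++ v :: Y := by
  constructor
  · rintro ⟨A, hA, hv, a, ha, hav, hmax⟩
    obtain ⟨h1, h2, X, Y, rfl, h3, h4⟩ := mem_runs_iff.1 hA
    obtain ⟨B, Z0, rfl, hB, hZ0⟩ := exists_append_takeWhile (fun x => decide (v < x)) X
    rcases A with _ | ⟨a', A⟩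
    · simp at ha
    obtain rfl : a' = a := by simpa using ha
    rcases List.eq_nil_or_concat' A with rfl | ⟨R, v', rfl⟩
    · simp at hv; omega
    obtain rfl : v' = v := by
      rw [Option.mem_def, getLast?_cons_concat] at hv
      simpa using hv
    have hlt : (a' :: (R ++ [v'])).Pairwise (· < ·) := by
      have hn : (a' :: (R ++ [v'])).Nodup := by
        rw [List.append_assoc] at hw
        exact (List.nodup_append.1 (List.nodup_append.1 hw).2.1).1
      exact (h2.pairwise.and hn).imp fun h => lt_of_le_of_ne h.1 h.2
    have hRv : ∀ x ∈ a' :: R, x < v' := by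
      have : (a' :: R ++ [v']).Pairwise (· < ·) := by simpa using hlt
      intro x hx
      exact (List.pairwise_append.1 this).2.2 x hx v' (by simp)
    simp only [decide_eq_true_eq] at hB
    have hvZ : v' ∉ Z0 := by
      intro h
      simp [List.nodup_append] at hw
      grind
    refine ⟨B, Z0 ++ a' :: R, Y, ⟨hB, ?_, ⟨Z0, a', R, rfl, ?_, hRv, ?_, ?_, ?_⟩, ?_⟩, by simp⟩
    · intro x hx
      rcases Z0 with _ | ⟨z, Z0⟩
      · obtain rfl : a' = x := by simpa using hx
        exact hav
      · obtain rfl : z = x := by simpa using hx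
        have h5 := hZ0 z (by simp)
        have h6 : z ≠ v' := by rintro rfl; simp at hvZ
        simp at h5
        omega
    · have : (a' :: R ++ [v']).Pairwise (· < ·) := by simpa using hlt
      exact (List.pairwise_append.1 this).1.isChain
    · intro x hx
      refine h3 x ?_ a' (by simp)
      rwa [List.getLast?_append_of_ne_nil]
      rintro rfl
      simp at hx
    · intro b hb hbv
      have h5 : IsStart (B ++ Z0) b := by
        refine hb.append_left fun x hx => ?_
        have := hB x (List.mem_of_getLast? hx)
        omega
      have h6 := hmax b (by rw [List.append_assoc]; exact h5.append_right _) hbv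
      have h7 : b ≠ a' := by
        rintro rfl
        have := mem_of_isStart hb
        simp [List.nodup_append] at hw
        grind
      omega
    · intro b hb hbv
      have h6 := hmax b (hb.append_left (by simpa [getLast?_cons_concat] using hbv)) hbv
      have h7 : b ≠ a' := by
        rintro rfl
        have := mem_of_isStart hb
        simp [List.nodup_append] at hw
        grind
      omega
    · exact h4 v' hv
  · rintro ⟨B, Z, Y, ⟨hB, hZ, ⟨Z0, a, R, rfl, hc, hlt, hl, h1, h2⟩, hY⟩, rfl⟩
    have hc' : (a :: R ++ [v]).Pairwise (· < ·) := by
      rw [List.pairwise_append]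
      exact ⟨hc.pairwise, by simp, by simpa using hlt⟩
    have e : B ++ (Z0 ++ a :: R) ++ v :: Y = (B ++ Z0) ++ (a :: R ++ [v]) ++ Y := by simp
    refine ⟨a :: R ++ [v], ?_, getLast?_cons_concat _ _ _, a, by simp, hlt a (by simp), ?_⟩
    · rw [mem_runs_iff]
      refine ⟨by simp, (hc'.imp le_of_lt).isChain, B ++ Z0, Y, e, ?_, by simpa [getLast?_cons_concat] using hY⟩
      intro x hx b hb
      obtain rfl : a = b := by simpa using hb
      rcases List.eq_nil_or_concat' Z0 with rfl | ⟨Z1, z, rfl⟩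
      · have := hB x (List.mem_of_getLast? (by simpa using hx))
        have := hlt a (by simp)
        omega
      · exact hl x (by simpa using hx)
    · intro b hb hbv
      rw [e] at hb
      rcases isStart_append hb with hb | hb
      · rcases isStart_append hb with hb | hb
        · rcases isStart_append hb with hb | hb
          · have := hB b (mem_of_isStart hb)
            omega
          · exact (h1 b hb hbv).le
        · exact (eq_of_isStart_of_isChain (by simpa using hc'.isChain) hb).le
      · exact (h2 b hb hbv).le

/-! ### Counting words with a prescribed top value -/

/-- The words that are rearrangements of `1, …, n`. -/
def words (n : ℕ) : Set (List ℕ) :=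
  {w | w.Perm (List.range' 1 n)}

theorem nodup_of_mem_words {n : ℕ} {w : List ℕ} (h : w ∈ words n) : w.Nodup :=
  h.nodup_iff.2 List.nodup_range'

theorem mem_words_of_perm {n : ℕ} {w w' : List ℕ} (h : w ∈ words n) (h' : w'.Perm w) :
    w' ∈ words n :=
  h'.trans h

theorem finite_words (n : ℕ) : (words n).Finite := by
  refine (List.finite_toSet (List.range' 1 n).permutations).subset fun w hw => ?_
  exact List.mem_permutations.2 hw

theorem oneLine_injective {n : ℕ} :
    Function.Injective (oneLine : Equiv.Perm (Fin n) → List ℕ) := by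
  intro σ τ h
  have := List.ofFn_injective h
  ext i
  have := congrFun this i
  simpa using this

theorem nodup_oneLine {n : ℕ} (σ : Equiv.Perm (Fin n)) : (oneLine σ).Nodup := by
  refine List.nodup_ofFn.2 fun i j h => σ.injective (Fin.ext ?_)
  simpa using h

theorem range_oneLine (n : ℕ) :
    Set.range (oneLine : Equiv.Perm (Fin n) → List ℕ) = words n := by
  ext w
  constructor
  · rintro ⟨σ, rfl⟩
    refine (List.perm_ext_iff_of_nodup (nodup_oneLine σ) List.nodup_range').2 fun a => ?_
    simp only [oneLine, List.mem_ofFn, List.mem_range'_1]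
    constructor
    · rintro ⟨i, rfl⟩
      omega
    · rintro ⟨h1, h2⟩
      exact ⟨σ.symm ⟨a - 1, by omega⟩, by simp; omega⟩
  · intro hw
    have hlen : w.length = n := by simpa using hw.length_eq
    have hmem : ∀ a ∈ w, 1 ≤ a ∧ a < 1 + n := fun a ha => by
      simpa [List.mem_range'_1] using hw.mem_iff.1 ha
    subst hlen
    let f : Fin w.length → Fin w.length := fun i =>
      ⟨w[i] - 1, by have := hmem w[i] (List.getElem_mem _); omega⟩
    have hf : Function.Injective f := by
      intro i j hij
      have h1 := hmem w[i] (List.getElem_mem _)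
      have h2 := hmem w[j] (List.getElem_mem _)
      have h3 : (w[i] : ℕ) = w[j] := by
        have := congrArg Fin.val hij
        simp only [f] at this
        omega
      exact (nodup_of_mem_words hw).injective_get h3
    refine ⟨Equiv.ofBijective f (Finite.injective_iff_bijective.1 hf), ?_⟩
    refine List.ext_getElem (by simp [oneLine]) fun i h1 h2 => ?_
    have := hmem w[i] (List.getElem_mem _)
    simp [oneLine, f]
    omega

/-- Double counting of pairs (permutation, value). It reduces an identity of expectations to one for
each value `v`. -/
theorem sum_ncard_eq {n : ℕ} (P : List ℕ → ℕ → Prop) (hP : ∀ w v, P w v → v ∈ w) :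
    ∑ σ : Equiv.Perm (Fin n), {v | P (oneLine σ) v}.ncard =
      ∑ v ∈ Finset.range (n + 1), {w | w ∈ words n ∧ P w v}.ncard := by
  classical
  have h1 : ∀ σ : Equiv.Perm (Fin n), {v | P (oneLine σ) v}.ncard =
      ∑ v ∈ Finset.range (n + 1), if P (oneLine σ) v then 1 else 0 := by
    intro σ
    rw [← Finset.card_filter, ← Set.ncard_coe_finset]
    congr 1
    ext v
    simp only [Set.mem_ofPred_eq, Finset.coe_filter, Finset.mem_range]
    refine ⟨fun h => ⟨?_, h⟩, fun h => h.2⟩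
    have h2 := hP _ _ h
    have h3 : oneLine σ ∈ words n := by rw [← range_oneLine]; exact ⟨σ, rfl⟩
    have := h3.mem_iff.1 h2
    rw [List.mem_range'_1] at this
    omega
  have h2 : ∀ v, {w | w ∈ words n ∧ P w v}.ncard =
      ∑ σ : Equiv.Perm (Fin n), if P (oneLine σ) v then 1 else 0 := by
    intro v
    rw [← Finset.card_filter, ← Finset.card_image_of_injective _ oneLine_injective,
      ← Set.ncard_coe_finset]
    congr 1
    ext w
    rw [← range_oneLine]
    simp only [Set.mem_ofPred_eq, Finset.coe_image, Finset.coe_filter, Finset.mem_univ, true_and,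
      Set.mem_image, Set.mem_range]
    constructor
    · rintro ⟨⟨σ, rfl⟩, h⟩
      exact ⟨σ, h, rfl⟩
    · rintro ⟨σ, h, rfl⟩
      exact ⟨⟨σ, rfl⟩, h⟩
  simp_rw [h1, h2]
  exact Finset.sum_comm

theorem ncard_ends_with_ascent_eq (n v : ℕ) :
    {w | w ∈ words n ∧ ∃ X p, w = X ++ [p, v] ∧ p < v}.ncard =
      {w | w ∈ words n ∧ ∃ p Y, w = v :: p :: Y ∧ p < v}.ncard := by
  rw [← Set.ncard_image_of_injective _ List.reverse_injective]
  congr 1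
  ext w
  simp only [Set.mem_image, Set.mem_ofPred_eq]
  constructor
  · rintro ⟨_, ⟨hw, X, p, rfl, hp⟩, rfl⟩
    exact ⟨mem_words_of_perm hw (List.reverse_perm _), p, X.reverse, by simp, hp⟩
  · rintro ⟨hw, p, Y, rfl, hp⟩
    exact ⟨(v :: p :: Y).reverse, ⟨mem_words_of_perm hw (List.reverse_perm _), Y.reverse, p,
      by simp, hp⟩, by simp⟩

/-- Both sets are injective images of the same set `T` of splits, under the two ways of assembling a
word from `B`, `Z`, `v`, `Y`. -/
theorem ncard_uncrossed_eq (n v : ℕ) :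
    {w | w ∈ words n ∧ IsUncrossedEnd w v}.ncard =
      {w | w ∈ words n ∧ ∃ p Y, w = v :: p :: Y ∧ p < v}.ncard := by
  let T : Set (List ℕ × List ℕ × List ℕ) :=
    {t | IsSplit v t.1 t.2.1 t.2.2 ∧ v :: (t.2.1 ++ t.1 ++ t.2.2) ∈ words n}
  have perm : ∀ B Z Y : List ℕ, (B ++ Z ++ v :: Y).Perm (v :: (Z ++ B ++ Y)) := fun B Z Y =>
    List.perm_middle.trans ((List.perm_append_comm.append_right Y).cons v)
  have hF : {w | w ∈ words n ∧ IsUncrossedEnd w v} =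
      (fun t : List ℕ × List ℕ × List ℕ => t.1 ++ t.2.1 ++ v :: t.2.2) '' T := by
    ext w
    simp only [Set.mem_ofPred_eq, Set.mem_image, T]
    constructor
    · rintro ⟨hw, h⟩
      obtain ⟨B, Z, Y, hs, rfl⟩ := (isUncrossedEnd_iff (nodup_of_mem_words hw)).1 h
      exact ⟨(B, Z, Y), ⟨hs, mem_words_of_perm hw (perm B Z Y).symm⟩, rfl⟩
    · rintro ⟨⟨B, Z, Y⟩, ⟨hs, hw⟩, rfl⟩
      have hw' := mem_words_of_perm hw (perm B Z Y)
      exact ⟨hw', (isUncrossedEnd_iff (nodup_of_mem_words hw')).2 ⟨B, Z, Y, hs, rfl⟩⟩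
  have hG : {w | w ∈ words n ∧ ∃ p Y, w = v :: p :: Y ∧ p < v} =
      (fun t : List ℕ × List ℕ × List ℕ => v :: (t.2.1 ++ t.1 ++ t.2.2)) '' T := by
    ext w
    simp only [Set.mem_ofPred_eq, Set.mem_image, T]
    constructor
    · rintro ⟨hw, p, τ, rfl, hp⟩
      have hn := List.nodup_cons.1 (nodup_of_mem_words hw)
      obtain ⟨B, Z, Y, hs, e⟩ := exists_isSplit hn.2 hn.1 hp
      exact ⟨(B, Z, Y), ⟨hs, by rwa [e] at hw⟩, by simp [e]⟩
    · rintro ⟨⟨B, Z, Y⟩, ⟨hs, hw⟩, rfl⟩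
      refine ⟨hw, ?_⟩
      rcases Z with _ | ⟨z, Z⟩
      · obtain ⟨Z0, a, R, e, -⟩ := hs.cut
        simp at e
      · exact ⟨z, Z ++ B ++ Y, by simp, hs.head_left z (by simp)⟩
  rw [hF, hG, Set.InjOn.ncard_image, Set.InjOn.ncard_image]
  · rintro ⟨B, Z, Y⟩ ⟨hs, hw⟩ ⟨B', Z', Y'⟩ ⟨hs', hw'⟩ e
    have hn := List.nodup_cons.1 (nodup_of_mem_words hw)
    obtain ⟨rfl, rfl, rfl⟩ := isSplit_unique hs hs' hn.2 (List.cons.inj e).2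
    rfl
  -- In this word the position of `v` isolates `Y`, and `B` is the longest prefix of letters above
  -- `v`, since `Z` starts below `v`.
  · rintro ⟨B, Z, Y⟩ ⟨hs, hw⟩ ⟨B', Z', Y'⟩ ⟨hs', hw'⟩ e
    have hn := nodup_of_mem_words (mem_words_of_perm hw (perm B Z Y))
    obtain ⟨e1, rfl⟩ := eq_of_append_cons_eq hn e
    have headFails : ∀ {B Z Y}, IsSplit v B Z Y → ∀ z ∈ Z.head?, decide (v < z) = false :=
      fun hs z hz => by simpa using (hs.head_left z hz).le
    obtain ⟨rfl, rfl⟩ := eq_and_eq_of_append_eq (p := fun x => decide (v < x)) e1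
      (by simpa using hs.lt_of_mem) (by simpa using hs'.lt_of_mem) (headFails hs) (headFails hs')
    rfl

theorem ncard_disjoint_or {n : ℕ} {E P Q : List ℕ → Prop}
    (h : ∀ w ∈ words n, E w ↔ P w ∨ Q w) (hd : ∀ w ∈ words n, P w → ¬ Q w) :
    {w | w ∈ words n ∧ E w}.ncard =
      {w | w ∈ words n ∧ P w}.ncard + {w | w ∈ words n ∧ Q w}.ncard := by
  rw [← Set.ncard_union_eq _ ((finite_words n).subset fun w hw => hw.1)
    ((finite_words n).subset fun w hw => hw.1)]
  · congr 1
    ext w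
    simp only [Set.mem_ofPred_eq, Set.mem_union]
    have := h w
    tauto
  · rw [Set.disjoint_left]
    rintro w ⟨hw, hP⟩ ⟨-, hQ⟩
    exact hd w hw hP hQ

/-- The long ends are counted in two ways, and the equinumerous uncrossed ends and final ascents are
cancelled. -/
theorem ncard_crossed_eq_ncard_peakTop (n v : ℕ) :
    {w | w ∈ words n ∧ IsCrossedEnd w v}.ncard = {w | w ∈ words n ∧ IsPeakTop w v}.ncard := by
  have h1 := ncard_disjoint_or (n := n) (E := (IsLongEnd · v)) (P := (IsCrossedEnd · v))
    (Q := (IsUncrossedEnd · v)) (fun w _ => isLongEnd_iff_crossed_or_uncrossed)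
    (fun w hw => not_uncrossed_of_crossed (nodup_of_mem_words hw))
  have h2 := ncard_disjoint_or (n := n) (E := (IsLongEnd · v)) (P := (IsPeakTop · v))
    (Q := fun w => ∃ X p, w = X ++ [p, v] ∧ p < v)
    (fun w hw => isLongEnd_iff (nodup_of_mem_words hw)) ?_
  · have h3 := ncard_uncrossed_eq n v
    have h4 := ncard_ends_with_ascent_eq n v
    omega
  · rintro w hw ⟨X, p, q, Y, rfl, -⟩ ⟨X', p', e, -⟩
    have hn := nodup_of_mem_words hw
    have := eq_of_append_cons_eq (X := X ++ [p]) (Y := q :: Y) (X' := X' ++ [p']) (Y' := [])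
      (v := v) (by simpa using hn) (by simpa using e)
    simp at this

theorem sum_peaks_runsort (n : ℕ) :
    ∑ σ : Equiv.Perm (Fin n), peaks (runsort (oneLine σ)) =
      ∑ σ : Equiv.Perm (Fin n), peaks (oneLine σ) := by
  have h1 : ∀ σ : Equiv.Perm (Fin n),
      peaks (runsort (oneLine σ)) = {v | IsCrossedEnd (oneLine σ) v}.ncard := by
    intro σ
    rw [peaks_eq_ncard ((runsort_perm _).nodup_iff.2 (nodup_oneLine σ))]
    simp_rw [(tops_runsort (nodup_oneLine σ)).2]
  have h2 : ∀ σ : Equiv.Perm (Fin n),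
      peaks (oneLine σ) = {v | IsPeakTop (oneLine σ) v}.ncard :=
    fun σ => peaks_eq_ncard (nodup_oneLine σ)
  simp_rw [h1, h2]
  rw [sum_ncard_eq, sum_ncard_eq]
  · exact Finset.sum_congr rfl fun v _ => ncard_crossed_eq_ncard_peakTop n v
  · rintro w v ⟨X, p, q, Y, rfl, -⟩
    simp
  · rintro w v ⟨A, hA, hv, -⟩
    have : v ∈ (runs w).flatten := List.mem_flatten.2 ⟨A, hA, List.mem_of_getLast? hv⟩
    rwa [runs, List.flatten_splitBy] at this

theorem des_runsort_eq_peaks_runsort {n : ℕ} (σ : Equiv.Perm (Fin n)) :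
    des (runsort (oneLine σ)) = peaks (runsort (oneLine σ)) := by
  have h := (runsort_perm _).nodup_iff.2 (nodup_oneLine σ)
  rw [des_eq_ncard h, peaks_eq_ncard h]
  simp_rw [tops_runsort (nodup_oneLine σ)]

/-! ### The expected number of peaks of a random permutation -/

/-- Exactly one of the three positions carries the largest value, and precomposing with a
transposition of two positions shows the three cases equally frequent. -/
theorem three_mul_card_middle_max {n : ℕ} {i j k : Fin n} (hij : i ≠ j) (hik : i ≠ k)
    (hjk : j ≠ k) :
    3 * (Finset.univ.filter fun σ : Equiv.Perm (Fin n) => σ i < σ j ∧ σ k < σ j).card =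
      n.factorial := by
  have swap_eq : ∀ a b c : Fin n, a ≠ b → a ≠ c → b ≠ c →
      (Finset.univ.filter fun σ : Equiv.Perm (Fin n) => σ a < σ b ∧ σ c < σ b).card =
        (Finset.univ.filter fun σ : Equiv.Perm (Fin n) => σ b < σ a ∧ σ c < σ a).card := by
    intro a b c hab hac hbc
    refine Finset.card_equiv (Equiv.mulRight (Equiv.swap a b)) fun σ => ?_
    simp [Equiv.swap_apply_of_ne_of_ne hac.symm hbc.symm]
  have h1 := swap_eq i j k hij hik hjk
  have h2 := swap_eq j k i hjk hij.symm hik.symm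
  have h3 : (Finset.univ : Finset (Equiv.Perm (Fin n))) =
      (Finset.univ.filter fun σ => σ i < σ j ∧ σ k < σ j) ∪
      ((Finset.univ.filter fun σ => σ j < σ i ∧ σ k < σ i) ∪
      (Finset.univ.filter fun σ => σ j < σ k ∧ σ i < σ k)) := by
    ext σ
    have e1 := σ.injective.ne hij
    have e2 := σ.injective.ne hik
    have e3 := σ.injective.ne hjk
    simp only [Finset.mem_univ, Finset.mem_union, Finset.mem_filter, true_and, true_iff]
    omega
  have h4 := congrArg Finset.card h3
  rw [Finset.card_union_of_disjoint, Finset.card_union_of_disjoint, Finset.card_univ,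
    Fintype.card_perm, Fintype.card_fin] at h4
  · have h5 : (Finset.univ.filter fun σ : Equiv.Perm (Fin n) => σ k < σ j ∧ σ i < σ j).card =
        (Finset.univ.filter fun σ : Equiv.Perm (Fin n) => σ i < σ j ∧ σ k < σ j).card := by
      simp_rw [and_comm]
    omega
  · rw [Finset.disjoint_filter]
    intro σ _ h
    omega
  · rw [Finset.disjoint_union_right, Finset.disjoint_filter, Finset.disjoint_filter]
    constructor <;> intro σ _ h <;> omega

theorem length_oneLine {n : ℕ} (σ : Equiv.Perm (Fin n)) : (oneLine σ).length = n := by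
  simp [oneLine]

theorem letter_oneLine {n : ℕ} (σ : Equiv.Perm (Fin n)) {k : ℕ} (h1 : 1 ≤ k) (h2 : k ≤ n) :
    letter (oneLine σ) k = σ ⟨k - 1, by omega⟩ + 1 := by
  unfold letter
  rw [List.getD_eq_getElem _ _ (by simp [oneLine]; omega)]
  simp [oneLine]

theorem three_mul_sum_peaks (n : ℕ) :
    3 * ∑ σ : Equiv.Perm (Fin n), peaks (oneLine σ) = (n - 2) * n.factorial := by
  have h1 : ∀ σ : Equiv.Perm (Fin n), peaks (oneLine σ) = ∑ i ∈ Finset.Ioo 1 n,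
      if letter (oneLine σ) (i - 1) < letter (oneLine σ) i ∧
        letter (oneLine σ) (i + 1) < letter (oneLine σ) i then 1 else 0 := by
    intro σ
    rw [← Finset.card_filter, peaks, peakSet, length_oneLine]
  simp_rw [h1]
  rw [Finset.sum_comm, Finset.mul_sum]
  have h2 : ∀ i ∈ Finset.Ioo 1 n, 3 * (∑ σ : Equiv.Perm (Fin n),
      if letter (oneLine σ) (i - 1) < letter (oneLine σ) i ∧
        letter (oneLine σ) (i + 1) < letter (oneLine σ) i then 1 else 0) = n.factorial := by
    intro i hi
    rw [Finset.mem_Ioo] at hi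
    -- Letters are counted from `1` and `Fin n` from `0`, hence the extra `- 1` in each index.
    rw [← three_mul_card_middle_max (n := n) (i := ⟨i - 1 - 1, by omega⟩)
      (j := ⟨i - 1, by omega⟩) (k := ⟨i + 1 - 1, by omega⟩) (by simp; omega) (by simp; omega)
      (by simp; omega), Finset.card_filter]
    congr 1
    refine Finset.sum_congr rfl fun σ _ => ?_
    rw [letter_oneLine σ (by omega) (by omega), letter_oneLine σ (by omega) (by omega),
      letter_oneLine σ (by omega) (by omega)]
    simp only [Nat.add_lt_add_iff_right, Fin.val_fin_lt]
  rw [Finset.sum_congr rfl h2, Finset.sum_const, Nat.card_Ioo, smul_eq_mul, Nat.sub_sub]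

end RunSort

theorem mainTheorem2 (n : ℕ) (hn : 2 ≤ n) :
    (𝔼 σ : Equiv.Perm (Fin n), (RunSort.des (RunSort.runsort (RunSort.oneLine σ)) : ℝ)
        = 𝔼 σ : Equiv.Perm (Fin n), (RunSort.peaks (RunSort.runsort (RunSort.oneLine σ)) : ℝ)) ∧
    (𝔼 σ : Equiv.Perm (Fin n), (RunSort.peaks (RunSort.runsort (RunSort.oneLine σ)) : ℝ)
        = 𝔼 σ : Equiv.Perm (Fin n), (RunSort.peaks (RunSort.oneLine σ) : ℝ)) ∧
    (𝔼 σ : Equiv.Perm (Fin n), (RunSort.peaks (RunSort.oneLine σ) : ℝ)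
        = ((n : ℝ) - 2) / 3) := by
  refine ⟨?_, ?_, ?_⟩
  · simp_rw [RunSort.des_runsort_eq_peaks_runsort]
  · rw [Fintype.expect_eq_sum_div_card, Fintype.expect_eq_sum_div_card, ← Nat.cast_sum,
      ← Nat.cast_sum, RunSort.sum_peaks_runsort]
  · have h : (3 : ℝ) * ∑ σ : Equiv.Perm (Fin n), (RunSort.peaks (RunSort.oneLine σ) : ℝ) =
        ((n : ℝ) - 2) * n.factorial := by
      have := congrArg (Nat.cast (R := ℝ)) (RunSort.three_mul_sum_peaks n)
      -- The truncated `n - 2` is a true difference because `2 ≤ n`.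
      push_cast [Nat.cast_sub hn] at this
      exact this
    have hpos : (n.factorial : ℝ) ≠ 0 := by positivity
    rw [Fintype.expect_eq_sum_div_card, Fintype.card_perm, Fintype.card_fin,
      div_eq_div_iff hpos (by norm_num)]
    linarith
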